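/- Let $X$ be a smooth complex projective variety of dimension $2n$, $\mathcal L$ an ample line bundle on $X$, and $k\ge 1$ an integer such that $\mathcal L^{k}$ is very ample. Let $S=|\mathcal L^{k}|=\mathbf P(H^0(X,\mathcal L^k))$, let $X_s\subset X$ be the zero divisor of the section corresponding to $s\in S$, let $\mathcal X=\{(x,s)\mid x\in X_s\}\subset X\times S$ be the universal family, and let $D=\{s\in S\mid X_s\text{ is singular}\}$ be its discriminant. Let $C\subset\mathbf C$ be an open disk with centre $0$ and coordinate $t$, and let $\nu:C\to S$ be a holomorphic map with $\nu^{-1}(D)=\{0\}$ (for instance the normalization of a germ of an irreducible analytic curve on $S$ which meets $D$ only at one point). Let $Y=\mathcal X\times_S C\subset X\times C$ be the base change of $\mathcal X\to S$ by $\nu$, as a complex analytic space, and let $Y_0=X_{\nu(0)}$ be its fibre over $0\in C$. Assume that all singularities of $Y_0$ are ordinary double points, i.e. that $(Y_0,y)$ is isomorphic to the germ $\big(\{\sum_{i=1}^{2n}x_i^2=0\},0\big)\subset(\mathbf C^{2n},0)$ for every $y\in\mathrm{Sing}\,Y_0$. Then: (i) Every singular point of the total space $Y$ is of the form $(y,0)$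 with $y\in\mathrm{Sing}\,Y_0$, and is a singularity of type $A_l$ for some $l\ge 1$, i.e. the germ of $Y$ is isomorphic to $\big(\{\sum_{i=1}^{2n}x_i^2+z^{l+1}=0\},0\big)\subset(\mathbf C^{2n}\times\mathbf C,0)$. (ii) For every $y\in\mathrm{Sing}\,Y_0$ there is an integer $l\ge 0$ and a system of local coordinates $(x_1,\dots,x_{2n},t)$ of $X\times C$ at $(y,0)$, whose last member is the coordinate $t$ of $C$, in which $Y$ is defined, as an analytic space, by the equation $$\sum_{i=1}^{2n}x_i^2=t^{\,l+1};$$ moreover $Y$ is singular at $(y,0)$ if and only if $l\ge1$. -/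

import Mathlib

open scoped Manifold ContDiff Topology TensorProduct LinearAlgebra.Projectivization

noncomputable section

namespace LinearSystemFamily

/-- The model space `ℂ^d` of complex manifolds of dimension `d`. -/
abbrev Cd (d : ℕ) : Type := EuclideanSpace ℂ (Fin d)

/-! ### Germs of hypersurfaces in complex manifolds -/

section Germs

variable {E H M E' H' M' : Type*}
  [NormedAddCommGroup E] [NormedSpace ℂ E] [TopologicalSpace H]
  [TopologicalSpace M] [ChartedSpace H M]
  [NormedAddCommGroup E'] [NormedSpace ℂ E'] [TopologicalSpace H']
  [TopologicalSpace M'] [ChartedSpace H' M']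

/-- `p` is a singular point of the hypersurface (with its possibly non-reduced structure) defined
near `p` by the holomorphic equation `F = 0`. -/
def IsSingularZero (I : ModelWithCorners ℂ E H) (F : M → ℂ) (p : M) : Prop :=
  F p = 0 ∧ mfderiv I 𝓘(ℂ, ℂ) F p = 0

/-- `φ` is a biholomorphic map from a neighbourhood of `p` onto a neighbourhood of `q` which carries
the hypersurface `F = 0` onto the hypersurface `G = 0`, as analytic spaces: the two ideals
`(F)` and `(G ∘ φ)` agree, i.e. `F` is `G ∘ φ` times a nowhere vanishing holomorphic function. -/
def IsGermIso (I : ModelWithCorners ℂ E H) (I' : ModelWithCorners ℂ E' H')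
    (φ : OpenPartialHomeomorph M M') (F : M → ℂ) (p : M) (G : M' → ℂ) (q : M') : Prop :=
  p ∈ φ.source ∧ φ p = q ∧
  ContMDiffOn I I' ω φ φ.source ∧ ContMDiffOn I' I ω φ.symm φ.target ∧
  ∃ u : M → ℂ, ContMDiffOn I 𝓘(ℂ, ℂ) ω u φ.source ∧
    ∀ z ∈ φ.source, u z ≠ 0 ∧ F z = u z * G (φ z)

/-- The hypersurface germ `(F = 0, p)` in a `d`-dimensional manifold is an ordinary double point:
it is isomorphic to `(∑ xᵢ² = 0, 0) ⊆ (ℂ^d, 0)`. -/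
def IsOrdinaryDoublePoint (d : ℕ) (I : ModelWithCorners ℂ E H) (F : M → ℂ) (p : M) : Prop :=
  ∃ φ : OpenPartialHomeomorph M (Cd d),
    IsGermIso I 𝓘(ℂ, Cd d) φ F p (fun x => ∑ i, x i ^ 2) 0

/-- The hypersurface germ `(F = 0, p)` in a `(d + 1)`-dimensional manifold is a (`d`-dimensional)
singularity of type `A_k`, `k ≥ 1`: it is isomorphic to
`(∑ xᵢ² + z^{k+1} = 0, 0) ⊆ (ℂ^d × ℂ, 0)`. -/
def IsTypeA (k d : ℕ) (I : ModelWithCorners ℂ E H) (F : M → ℂ) (p : M) : Prop :=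
  1 ≤ k ∧ ∃ φ : OpenPartialHomeomorph M (Cd d × ℂ),
    IsGermIso I 𝓘(ℂ, Cd d × ℂ) φ F p (fun w => (∑ i, w.1 i ^ 2) + w.2 ^ (k + 1)) 0

end Germs

/-! ### The linear system `|L^k|` of a holomorphic line bundle `L` -/

section LinearSystem

variable {d : ℕ} {X : Type*} [TopologicalSpace X] [ChartedSpace (Cd d) X]
  (L : X → Type*) [∀ x, AddCommGroup (L x)] [∀ x, Module ℂ (L x)]
  [∀ x, TopologicalSpace (L x)] [TopologicalSpace (Bundle.TotalSpace ℂ L)]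
  [FiberBundle ℂ L] [VectorBundle ℂ ℂ L] (k : ℕ)

/-- The linear map `L_x^{⊗k} → ℂ^{⊗k} = ℂ` induced by the preferred trivialization of `L` at `x₀`;
an isomorphism for `x` in the base set of this trivialization. -/
def powCoord (x₀ x : X) : (⨂[ℂ]^k (L x)) →ₗ[ℂ] ℂ :=
  PiTensorProduct.lift ((MultilinearMap.mkPiAlgebra ℂ (Fin k) ℂ).compLinearMap
    fun _ => (trivializationAt ℂ L x₀).linearMapAt ℂ x)

/-- The function representing a section of `L^{⊗k}` in the preferred trivialization at `x₀`. -/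
def localFun (x₀ : X) (s : ∀ x, ⨂[ℂ]^k (L x)) : X → ℂ :=
  fun x => powCoord L k x₀ x (s x)

/-- The space `H⁰(X, L^{⊗k})` of global holomorphic sections of `L^{⊗k}`. -/
def H0 : Submodule ℂ (∀ x, ⨂[ℂ]^k (L x)) where
  carrier := {s | ∀ x₀, ContMDiffOn 𝓘(ℂ, Cd d) 𝓘(ℂ, ℂ) ω (localFun L k x₀ s)
    (trivializationAt ℂ L x₀).baseSet}
  add_mem' := by
    intro s s' hs hs' x₀
    have h : localFun L k x₀ (s + s') = localFun L k x₀ s + localFun L k x₀ s' := by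
      funext x; simp [localFun]
    rw [h]
    exact (hs x₀).add (hs' x₀)
  zero_mem' := by
    intro x₀
    have h : localFun L k x₀ 0 = fun _ => (0 : ℂ) := by
      funext x; simp [localFun]
    rw [h]
    exact contMDiffOn_const
  smul_mem' := by
    intro c s hs x₀
    have h : localFun L k x₀ (c • s) = fun x => c • localFun L k x₀ s x := by
      funext x; simp [localFun]
    rw [h]
    exact (contDiff_const_smul (𝕜 := ℂ) (n := ω) c).contMDiff.comp_contMDiffOn (hs x₀)

/-- `L^{⊗k}` is very ample: its global sections have no base points and separate points and
tangent vectors. -/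
def IsVeryAmplePow : Prop :=
  (∀ x : X, ∃ s ∈ H0 (d := d) L k, s x ≠ 0) ∧
  (∀ x y : X, x ≠ y → ∃ s ∈ H0 (d := d) L k, s x = 0 ∧ s y ≠ 0) ∧
  (∀ (x : X) (v : TangentSpace 𝓘(ℂ, Cd d) x), v ≠ 0 →
    ∃ s ∈ H0 (d := d) L k, s x = 0 ∧ mfderiv 𝓘(ℂ, Cd d) 𝓘(ℂ, ℂ) (localFun L k x s) x v ≠ 0)

/-- The complete linear system `S = |L^{⊗k}|`, the projective space of lines in
`H⁰(X, L^{⊗k})`. -/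
abbrev LinSys : Type _ := ℙ ℂ (H0 (d := d) L k)

/-- A local equation near `x` of the member `X_s ⊆ X` (the zero divisor of the section `s`). -/
def memberEq (s : LinSys (d := d) L k) (x : X) : X → ℂ := localFun L k x s.rep

/-- `Sing X_s`. -/
def singMember (s : LinSys (d := d) L k) : Set X :=
  {x | IsSingularZero 𝓘(ℂ, Cd d) (memberEq L k s x) x}

/-- The discriminant `D ⊆ S`: the parameters of the singular members. -/
def discriminant : Set (LinSys (d := d) L k) := {s | (singMember L k s).Nonempty}

/-! ### Base change of the universal family to a curve -/

/-- `a` is a holomorphic lift of `ν` to `H⁰(X, L^{⊗k}) ∖ {0}` near `t₀`, i.e. a representation of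
`ν` by homogeneous coordinates that are holomorphic and have no common zero. -/
def IsLocalLift (ν : ℂ → LinSys (d := d) L k) (t₀ : ℂ) (a : ℂ → H0 (d := d) L k) : Prop :=
  (∃ (m : ℕ) (σ : Fin m → H0 (d := d) L k) (c : Fin m → ℂ → ℂ),
    (∀ j, AnalyticAt ℂ (c j) t₀) ∧ ∀ᶠ t in 𝓝 t₀, a t = ∑ j, c j t • σ j) ∧
  ∀ᶠ t in 𝓝 t₀, ∃ h : a t ≠ 0, ν t = Projectivization.mk ℂ (a t) h

/-- The map `ν` to the projective space `S` is holomorphic on the open set `C`. -/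
def IsHolomorphicOn (ν : ℂ → LinSys (d := d) L k) (C : Set ℂ) : Prop :=
  ∀ t₀ ∈ C, ∃ a, IsLocalLift L k ν t₀ a

/-- `F` is a local equation near `p = (x, t)` of the total space `Y ⊆ X × C` of the base change by
`ν : C → S` of the universal family `𝒳 = {(x, s) | x ∈ X_s} ⊆ X × S`. The equation of `𝒳` is the
value at `x` of the section with homogeneous coordinates `s`, so that of `Y` is `a(t)(x) = 0`, with
`a` a local lift of `ν`. -/
def IsTotalSpaceEq (ν : ℂ → LinSys (d := d) L k) (p : X × ℂ) (F : X × ℂ → ℂ) : Prop :=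
  ∃ a, IsLocalLift L k ν p.2 a ∧ F = fun z => localFun L k p.1 (a z.2) z.1

/-- `Sing Y`, for the total space `Y ⊆ X × C`. -/
def singTotalSpace (ν : ℂ → LinSys (d := d) L k) (C : Set ℂ) : Set (X × ℂ) :=
  {p | p.2 ∈ C ∧ ∃ F, IsTotalSpaceEq L k ν p F ∧
    IsSingularZero (𝓘(ℂ, Cd d).prod 𝓘(ℂ, ℂ)) F p}

end LinearSystem

end LinearSystemFamily

end

/-! Near an ordinary double point of `Y₀`, the total space is given by an analytic function `g (x,
t)` with `g (x, 0) = ∑ xᵢ²`. This quadratic form is nondegenerate, so the critical point at the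
origin persists for small `t` and traces an analytic arc `ξ t` (`exists_analyticAt_critical_arc`).
The Morse lemma with parameter then writes `g` as the critical value `c t = g (ξ t, t)` plus a
nondegenerate quadratic form in `x - ξ t` whose coefficients are analytic in `(x, t)`.

If `c` vanished identically, every nearby fibre would be singular at `ξ t`, contrary to `ν⁻¹(D) =
{0}`. Hence `c t = t ^ (l + 1) * e t` with `e 0 ≠ 0`. Dividing by `-e` and taking a square root of
the rescaled matrix of the quadratic form gives `∑ xᵢ² = t ^ (l + 1)` without changing `t`
(`exists_normal_form`). The differential at the origin shows that this hypersurface is singular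
exactly when `l ≥ 1`, and an `(l + 1)`-th root of `-1` turns it into the standard `A_l` equation.

The Morse lemma rests on two tools: Hadamard division in the analytic category, applied twice
(`exists_analyticAt_eq_add_apply_fst`), and symmetric square roots of symmetric matrices near the
identity (`exists_analyticAt_symmetric_sqrt`). Globally, a singular point of `Y` is singular in its
own fibre, so it lies over `0`. -/

namespace LinearSystemFamily

/-! ### Hadamard division for analytic functions. -/

section DifferenceQuotient

variable {𝕜 E F : Type*} [NontriviallyNormedField 𝕜] [NormedAddCommGroup E] [NormedSpace 𝕜 E]
  [NormedAddCommGroup F] [NormedSpace 𝕜 F]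

/-- The power series of the difference quotient of the sum of `p`: the term of degree `n` sends
`(aᵢ, bᵢ)ᵢ` to the linear map `v ↦ ∑ⱼ p (b₁, …, bⱼ, v, aⱼ₊₁, …, aₙ)`. -/
noncomputable def differenceSeries (p : FormalMultilinearSeries 𝕜 E F) :
    FormalMultilinearSeries 𝕜 (E × E) (E →L[𝕜] F) := fun n =>
  ∑ j : Fin (n + 1), ((p (n + 1)).curryMid j).flipMultilinear.compContinuousLinearMap
      fun i => if i.castSucc < j then ContinuousLinearMap.snd 𝕜 E E
        else ContinuousLinearMap.fst 𝕜 E E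

theorem norm_differenceSeries_le (p : FormalMultilinearSeries 𝕜 E F) (n : ℕ) :
    ‖differenceSeries p n‖ ≤ (n + 1) * ‖p (n + 1)‖ := by
  have key : ∀ j : Fin (n + 1),
      ‖((p (n + 1)).curryMid j).flipMultilinear.compContinuousLinearMap
        fun i => if i.castSucc < j then ContinuousLinearMap.snd 𝕜 E E
          else ContinuousLinearMap.fst 𝕜 E E‖ ≤ ‖p (n + 1)‖ := by
    intro j
    refine ContinuousMultilinearMap.opNorm_le_bound (norm_nonneg _) fun m => ?_
    refine ContinuousLinearMap.opNorm_le_bound _ (by positivity) fun v => ?_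
    refine ((p (n + 1)).norm_map_insertNth_le v _).trans ?_
    rw [mul_right_comm]
    gcongr with i
    dsimp only
    split_ifs
    · exact norm_snd_le _
    · exact norm_fst_le _
  refine (norm_sum_le (E := (E × E) [×n]→L[𝕜] (E →L[𝕜] F)) _ _).trans ?_
  refine (Finset.sum_le_card_nsmul _ _ _ fun j _ => key j).trans ?_
  simp

/-- From `‖p n‖ ≤ C * r ^ n`, the extra factor `n + 1 ≤ 2 ^ n` is absorbed by halving the radius
`r⁻¹`. -/
theorem differenceSeries_radius_pos {p : FormalMultilinearSeries 𝕜 E F} (hp : 0 < p.radius) :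
    0 < (differenceSeries p).radius := by
  obtain ⟨C, r, hC, hr, h⟩ := p.le_mul_pow_of_radius_pos hp
  have hρ : (0 : ℝ) < (2 * r)⁻¹ := by positivity
  refine lt_of_lt_of_le ?_ ((differenceSeries p).le_radius_of_bound (C * r)
    (r := ⟨(2 * r)⁻¹, hρ.le⟩) fun n => ?_)
  · exact ENNReal.coe_pos.2 hρ
  · have h2 : ((n : ℝ) + 1) ≤ 2 ^ n := by exact_mod_cast Nat.lt_two_pow_self (n := n)
    calc ‖differenceSeries p n‖ * ((2 * r)⁻¹) ^ n
        ≤ ((n + 1) * ‖p (n + 1)‖) * ((2 * r)⁻¹) ^ n := by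
          gcongr; exact norm_differenceSeries_le p n
      _ ≤ (2 ^ n * (C * r ^ (n + 1))) * ((2 * r)⁻¹) ^ n := by gcongr; exact h _
      _ = C * r := by rw [inv_pow, mul_pow, pow_succ]; field_simp

/-- Telescoping: the arguments `a` are replaced by `b` one slot at a time, and linearity in slot `j`
identifies the `j`-th term of the series with the `j`-th replacement. -/
theorem differenceSeries_apply_sub (p : FormalMultilinearSeries 𝕜 E F) (n : ℕ) (a b : E) :
    differenceSeries p n (fun _ => (a, b)) (a - b) =
      p (n + 1) (fun _ => a) - p (n + 1) (fun _ => b) := by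
  let v : ℕ → Fin (n + 1) → E := fun j i => if (i : ℕ) < j then b else a
  have hterm : ∀ j : Fin (n + 1),
      (((p (n + 1)).curryMid j).flipMultilinear.compContinuousLinearMap
        fun i => if i.castSucc < j then ContinuousLinearMap.snd 𝕜 E E
          else ContinuousLinearMap.fst 𝕜 E E) (fun _ => (a, b)) (a - b) =
      p (n + 1) (v j) - p (n + 1) (v (j + 1)) := by
    intro j
    have h1 : (((p (n + 1)).curryMid j).flipMultilinear.compContinuousLinearMap
        fun i => if i.castSucc < j then ContinuousLinearMap.snd 𝕜 E E
          else ContinuousLinearMap.fst 𝕜 E E) (fun _ => (a, b)) (a - b) =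
        p (n + 1) (Function.update (v j) j (a - b)) := by
      change p (n + 1) (j.insertNth (a - b) _) = _
      congr 1
      refine Fin.insertNth_eq_iff.2 ⟨by simp, ?_⟩
      funext i
      simp only [Fin.removeNth, Function.update_of_ne (Fin.succAbove_ne j i), v]
      by_cases hij : i.castSucc < j
      · rw [Fin.succAbove_of_castSucc_lt _ _ hij]
        have : (i : ℕ) < j := hij
        simp [hij, this]
      · rw [Fin.succAbove_of_le_castSucc _ _ (not_lt.1 hij)]
        have : ¬ ((i : ℕ) + 1 < j) := fun h => hij (by
          rw [Fin.lt_def]; simp; omega)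
        simp [hij, this]
    have ha : Function.update (v j) j a = v j := by
      rw [Function.update_eq_self_iff]; simp [v]
    have hb : Function.update (v j) j b = v (j + 1) := by
      funext i
      by_cases hi : i = j
      · subst hi; simp [v]
      · have : (i : ℕ) ≠ j := fun h => hi (Fin.ext h)
        have h' : (i : ℕ) < j + 1 ↔ (i : ℕ) < j := by omega
        simp [v, hi, h']
    rw [h1, ContinuousMultilinearMap.map_update_sub, ha, hb]
  have h0 : v 0 = fun _ => a := by funext i; simp [v]
  have h1 : v (n + 1) = fun _ => b := by funext i; simp [v, i.2]
  simp only [differenceSeries, sum_apply]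
  rw [Finset.sum_congr rfl fun j _ => hterm j,
    Fin.sum_univ_eq_sum_range (fun j => p (n + 1) (v j) - p (n + 1) (v (j + 1))),
    Finset.sum_range_sub', h0, h1]

/-- The difference quotient of an analytic function is analytic. -/
theorem exists_analyticAt_sub_eq [CompleteSpace F] {f : E → F} {x : E} (hf : AnalyticAt 𝕜 f x) :
    ∃ Q : E × E → E →L[𝕜] F, AnalyticAt 𝕜 Q (x, x) ∧
      ∀ᶠ z in 𝓝 (x, x), f z.1 - f z.2 = Q z (z.1 - z.2) := by
  obtain ⟨p, hp⟩ := hf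
  have hD := (differenceSeries p).hasFPowerSeriesOnBall (differenceSeries_radius_pos hp.radius_pos)
  have hD' := hD.comp_sub (x, x)
  rw [zero_add] at hD'
  refine ⟨_, hD'.analyticAt, ?_⟩
  have hz : Filter.Tendsto (fun z : E × E => z - (x, x)) (𝓝 (x, x)) (𝓝 0) := by
    have : Continuous fun z : E × E => z - (x, x) := by fun_prop
    simpa using this.tendsto (x, x)
  have h1 : Filter.Tendsto (fun z : E × E => z.1 - x) (𝓝 (x, x)) (𝓝 0) := by
    have : Continuous fun z : E × E => z.1 - x := by fun_prop
    simpa using this.tendsto (x, x)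
  have h2 : Filter.Tendsto (fun z : E × E => z.2 - x) (𝓝 (x, x)) (𝓝 0) := by
    have : Continuous fun z : E × E => z.2 - x := by fun_prop
    simpa using this.tendsto (x, x)
  filter_upwards [h1.eventually hp.eventually_hasSum, h2.eventually hp.eventually_hasSum,
    hz.eventually hD.hasFPowerSeriesAt.eventually_hasSum] with z ha hb hQ
  rw [add_sub_cancel] at ha hb
  -- The constant terms of the two expansions cancel. Dropping them shifts the index by one, which
  -- matches the degree of `differenceSeries`.
  have hab := (hasSum_nat_add_iff' 1).2 (ha.sub hb)
  have hQ' := (ContinuousLinearMap.apply 𝕜 F (z.1 - z.2)).hasSum hQ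
  have hkey := differenceSeries_apply_sub p
  rw [zero_add] at hQ'
  have e : ∀ n, (ContinuousLinearMap.apply 𝕜 F (z.1 - z.2))
      (differenceSeries p n fun _ => z - (x, x)) =
      (p (n + 1) fun _ => z.1 - x) - p (n + 1) fun _ => z.2 - x := by
    intro n
    rw [← hkey n (z.1 - x) (z.2 - x), sub_sub_sub_cancel_right]
    rfl
  have e0 : (p 0 fun _ => z.1 - x) = p 0 fun _ => z.2 - x :=
    congrArg (p 0) (Subsingleton.elim _ _)
  simp only [Finset.sum_range_one, e0, sub_self, sub_zero] at hab
  simp only [e] at hQ'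
  exact (hab.unique hQ')

/-- A function which is analytic at the origin is a function of the second variable plus an
analytic multiple of the first variable. -/
theorem exists_analyticAt_eq_add_apply_fst {E' : Type*} [NormedAddCommGroup E'] [NormedSpace 𝕜 E']
    [CompleteSpace F] {h : E × E' → F} (hh : AnalyticAt 𝕜 h 0) :
    ∃ Q : E × E' → E →L[𝕜] F, AnalyticAt 𝕜 Q 0 ∧ ∀ᶠ z in 𝓝 0, h z = h (0, z.2) + Q z z.1 := by
  obtain ⟨Q, hQ, hQ'⟩ := exists_analyticAt_sub_eq hh
  have hin : AnalyticAt 𝕜 (fun z : E × E' => (z, ((0 : E), z.2))) 0 :=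
    analyticAt_id.prod (analyticAt_const.prod analyticAt_snd)
  have hin' := hin.continuousAt.tendsto
  have hcomp : AnalyticAt 𝕜 (fun z : E × E' => Q (z, ((0 : E), z.2))) 0 :=
    AnalyticAt.fun_comp (f := fun z : E × E' => (z, ((0 : E), z.2))) hQ hin
  -- The points `z` and `(0, z.2)` differ by `(z.1, 0)`, so only the restriction of the difference
  -- quotient to the first factor matters.
  refine ⟨fun z => (Q (z, (0, z.2))).comp (ContinuousLinearMap.inl 𝕜 E E'), ?_, ?_⟩
  · exact ((ContinuousLinearMap.compL 𝕜 E (E × E') F).flip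
      (ContinuousLinearMap.inl 𝕜 E E')).analyticAt _ |>.fun_comp hcomp
  · filter_upwards [hin'.eventually hQ'] with z hz
    rw [← sub_eq_iff_eq_add']
    refine hz.trans ?_
    simp only [ContinuousLinearMap.comp_apply, ContinuousLinearMap.inl_apply]
    congr 1
    ext <;> simp

end DifferenceQuotient

/-! ### Analytic inverse function theorems. -/

section InverseFunction

variable {E F : Type*} [NormedAddCommGroup E] [NormedSpace ℂ E] [CompleteSpace E]
  [NormedAddCommGroup F] [NormedSpace ℂ F] [CompleteSpace F]

/-- The analytic inverse function theorem, on an arbitrarily small neighbourhood. -/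
theorem exists_openPartialHomeomorph_of_analyticAt {f : E → F} {f' : E ≃L[ℂ] F} {a : E}
    (hf : AnalyticAt ℂ f a) (hf' : HasFDerivAt f (f' : E →L[ℂ] F) a) {N : Set E} (hN : N ∈ 𝓝 a) :
    ∃ Φ : OpenPartialHomeomorph E F, a ∈ Φ.source ∧ Φ.source ⊆ N ∧ (∀ z, Φ z = f z) ∧
      AnalyticOnNhd ℂ Φ Φ.source ∧ AnalyticOnNhd ℂ Φ.symm Φ.target := by
  have hc : ContDiffAt ℂ ω f a := hf.contDiffAt
  have hω : (ω : WithTop ℕ∞) ≠ 0 := by simp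
  let Ψ := hc.toOpenPartialHomeomorph f hf' hω
  have ha : a ∈ Ψ.source := hc.mem_toOpenPartialHomeomorph_source hf' hω
  have hsymm : AnalyticAt ℂ Ψ.symm (f a) := (hc.to_localInverse hf' hω).analyticAt
  -- Analyticity is an open condition, so the source can be shrunk until `f` is analytic throughout
  -- it and the inverse throughout its image.
  have hev : ∀ᶠ z in 𝓝 a, z ∈ N ∧ AnalyticAt ℂ f z ∧ AnalyticAt ℂ Ψ.symm (f z) :=
    (Filter.eventually_mem_set.2 hN).and (hf.eventually_analyticAt.and
      (hf.continuousAt.eventually hsymm.eventually_analyticAt))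
  obtain ⟨U, hU, hUo, haU⟩ := eventually_nhds_iff.1 hev
  refine ⟨Ψ.restrOpen U hUo, ⟨ha, haU⟩, fun z hz => (hU z hz.2).1, fun z => rfl,
    fun z hz => (hU z hz.2).2.1, fun w hw => ?_⟩
  have hw' : w ∈ (Ψ.restrOpen U hUo).target := hw
  have h1 := (Ψ.restrOpen U hUo).map_target hw'
  have h2 := (hU _ h1.2).2.2
  have h3 : f ((Ψ.restrOpen U hUo).symm w) = w := (Ψ.restrOpen U hUo).right_inv hw'
  rw [h3] at h2
  exact h2

/-- The analytic inverse function theorem for maps over `F`. -/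
theorem exists_openPartialHomeomorph_prod {P : E × F → E} (hP : AnalyticAt ℂ P 0) {γ : ℂ}
    (hγ : γ ≠ 0)
    (hd : HasFDerivAt (fun x => P (x, 0)) (γ • ContinuousLinearMap.id ℂ E) 0)
    {N : Set (E × F)} (hN : N ∈ 𝓝 0) :
    ∃ Φ : OpenPartialHomeomorph (E × F) (E × F), 0 ∈ Φ.source ∧ Φ.source ⊆ N ∧
      (∀ z, Φ z = (P z, z.2)) ∧
      AnalyticOnNhd ℂ Φ Φ.source ∧ AnalyticOnNhd ℂ Φ.symm Φ.target := by
  have hL := hP.differentiableAt.hasFDerivAt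
  set L := fderiv ℂ P 0
  have hL1 : ∀ v, L (v, 0) = γ • v := by
    have h1 : HasFDerivAt (fun x : E => P (x, 0)) (L.comp (ContinuousLinearMap.inl ℂ E F)) 0 :=
      HasFDerivAt.comp (f := fun x : E => (x, (0 : F))) 0 hL
        (ContinuousLinearMap.inl ℂ E F).hasFDerivAt
    intro v
    simpa using congrArg (fun T => T v) (h1.unique hd)
  have hadd : ∀ v τ, L (v, τ) = γ • v + L (0, τ) := by
    intro v τ
    rw [← hL1, ← map_add]; simp
  -- The differential of `z ↦ (P z, z.2)` is block triangular with diagonal blocks `γ • id` and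
  -- `id`; `B` is its explicit inverse.
  let A : (E × F) →L[ℂ] (E × F) := L.prod (ContinuousLinearMap.snd ℂ E F)
  let B : (E × F) →L[ℂ] (E × F) :=
    (γ⁻¹ • (ContinuousLinearMap.fst ℂ E F - (L.comp (ContinuousLinearMap.inr ℂ E F)).comp
      (ContinuousLinearMap.snd ℂ E F))).prod (ContinuousLinearMap.snd ℂ E F)
  let e : (E × F) ≃L[ℂ] (E × F) := ContinuousLinearEquiv.equivOfInverse A B
    (by rintro ⟨v, τ⟩; simp [A, B, hadd v τ, hγ])
    (by rintro ⟨v, τ⟩; simp [A, B, hadd (γ⁻¹ • (v - L (0, τ))) τ, hγ])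
  have he : (e : (E × F) →L[ℂ] (E × F)) = L.prod (ContinuousLinearMap.snd ℂ E F) := rfl
  exact exists_openPartialHomeomorph_of_analyticAt (f := fun z : E × F => (P z, z.2)) (f' := e)
    (hP.prod analyticAt_snd) (he ▸ hL.prodMk hasFDerivAt_snd) hN

end InverseFunction

/-! ### Symmetric square roots of matrices near the identity. -/

section MatrixSqrt

/-- An analytic family of symmetric matrices near the identity has an analytic family of symmetric
square roots. -/
theorem exists_analyticAt_symmetric_sqrt {E : Type*} [NormedAddCommGroup E] [NormedSpace ℂ E]
    {ι : Type*} [Fintype ι] [DecidableEq ι] {N : E → Matrix ι ι ℂ} {p : E}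
    (hN : ∀ i j, AnalyticAt ℂ (fun z => N z i j) p) (hp : N p = 1)
    (hsymm : ∀ z, (N z).transpose = N z) :
    ∃ S : E → Matrix ι ι ℂ, (∀ i j, AnalyticAt ℂ (fun z => S z i j) p) ∧ S p = 1 ∧
      ∀ᶠ z in 𝓝 p, (S z).transpose = S z ∧ S z * S z = N z := by
  let : NormedRing (Matrix ι ι ℂ) := Matrix.linftyOpNormedRing
  let : NormedAlgebra ℂ (Matrix ι ι ℂ) := Matrix.linftyOpNormedAlgebra
  have : CompleteSpace (Matrix ι ι ℂ) := FiniteDimensional.complete ℂ _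
  have hsq : AnalyticAt ℂ (fun B : Matrix ι ι ℂ => B * B) 1 := analyticAt_id.mul analyticAt_id
  -- The differential of `B ↦ B * B` at `1` is multiplication by `2`, so squaring is locally
  -- invertible there.
  let e : Matrix ι ι ℂ ≃L[ℂ] Matrix ι ι ℂ :=
    ContinuousLinearEquiv.smulLeft (Units.mk0 (2 : ℂ) two_ne_zero)
  have hd : HasFDerivAt (fun B : Matrix ι ι ℂ => B * B)
      (e : Matrix ι ι ℂ →L[ℂ] Matrix ι ι ℂ) 1 := by
    have hid := hasFDerivAt_id (𝕜 := ℂ) (1 : Matrix ι ι ℂ)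
    refine (hid.mul' hid).congr_fderiv ?_
    ext1 B
    change (1 : Matrix ι ι ℂ) • B + MulOpposite.op (1 : Matrix ι ι ℂ) • B = (2 : ℂ) • B
    rw [one_smul, MulOpposite.op_one, one_smul, two_smul]
  obtain ⟨Φ, h1, -, hΦ, -, hΦs⟩ := exists_openPartialHomeomorph_of_analyticAt hsq hd Filter.univ_mem
  have hNan : AnalyticAt ℂ N p := by
    have : AnalyticAt ℂ (fun z => ∑ i, ∑ j, N z i j • Matrix.single i j (1 : ℂ)) p :=
      Finset.analyticAt_fun_sum _ fun i _ => Finset.analyticAt_fun_sum _ fun j _ =>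
        (hN i j).smul analyticAt_const
    convert this using 1
    funext z
    conv_lhs => rw [Matrix.matrix_eq_sum_single (N z)]
    simp
  have hone : Φ 1 = 1 := by rw [hΦ, one_mul]
  have hone' : Φ.symm 1 = 1 := by
    conv_lhs => rw [← hone]
    exact Φ.left_inv h1
  have ht : (1 : Matrix ι ι ℂ) ∈ Φ.target := hone ▸ Φ.map_source h1
  have hSan : AnalyticAt ℂ (fun z => Φ.symm (N z)) p :=
    AnalyticAt.fun_comp (hp.symm ▸ hΦs 1 ht) hNan
  have hSp : Φ.symm (N p) = 1 := by rw [hp, hone']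
  refine ⟨fun z => Φ.symm (N z), fun i j => ?_, hSp, ?_⟩
  · let ev : Matrix ι ι ℂ →L[ℂ] ℂ := LinearMap.toContinuousLinearMap (Matrix.entryLinearMap ℂ ℂ i j)
    exact (ev.analyticAt _).fun_comp hSan
  · have hTc : Continuous fun B : Matrix ι ι ℂ => B.transpose :=
      (LinearMap.toContinuousLinearMap (Matrix.transposeLinearEquiv ι ι ℂ ℂ).toLinearMap).continuous
    have hT : Filter.Tendsto (fun z => (Φ.symm (N z)).transpose) (𝓝 p) (𝓝 1) := by
      have := (hTc.continuousAt.comp hSan.continuousAt).tendsto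
      simpa [Function.comp_def, hSp] using this
    have hNt := hNan.continuousAt.eventually_mem (hp.symm ▸ Φ.open_target.mem_nhds ht)
    filter_upwards [hT.eventually_mem (Φ.open_source.mem_nhds h1), hNt] with z hz hz'
    have hsq' : Φ.symm (N z) * Φ.symm (N z) = N z := by rw [← hΦ]; exact Φ.right_inv hz'
    -- The transpose of the root is again a root of the symmetric matrix `N z`, and it is still
    -- close to `1`; injectivity of squaring there makes the two equal.
    refine ⟨Φ.injOn hz (Φ.map_target hz') ?_, hsq'⟩
    rw [hΦ, hΦ, ← Matrix.transpose_mul, hsq', hsymm]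

end MatrixSqrt

/-! ### Morse lemma with parameter and the normal form of a deformation of `∑ xᵢ²`. -/

section NormalForm

variable {d : ℕ}

/-- The critical points of an analytic deformation of `∑ xᵢ²` form an analytic arc. -/
theorem exists_analyticAt_critical_arc {g : Cd d × ℂ → ℂ} (hg : AnalyticAt ℂ g 0)
    (hg0 : ∀ᶠ x : Cd d in 𝓝 0, g (x, 0) = ∑ i, x i ^ 2) :
    ∃ ξ : ℂ → Cd d, AnalyticAt ℂ ξ 0 ∧ ξ 0 = 0 ∧
      ∀ᶠ t in 𝓝 0, HasFDerivAt (fun x => g (x, t)) (0 : Cd d →L[ℂ] ℂ) (ξ t) := by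
  -- Half the gradient in `x`: the factor `1 / 2` makes `P (x, 0) = x` near the origin. The critical
  -- arc is then the preimage of the `t`-axis under `(x, t) ↦ (P (x, t), t)`.
  let P : Cd d × ℂ → Cd d := fun z =>
    WithLp.toLp 2 fun i => (1 / 2 : ℂ) * fderiv ℂ g z (EuclideanSpace.single i 1, 0)
  have hslice : ∀ {x : Cd d} {t : ℂ}, AnalyticAt ℂ g (x, t) → HasFDerivAt (fun x => g (x, t))
      ((fderiv ℂ g (x, t)).comp (ContinuousLinearMap.inl ℂ (Cd d) ℂ)) x := fun {x t} h =>
    HasFDerivAt.comp (f := fun x : Cd d => (x, t)) x h.differentiableAt.hasFDerivAt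
      (hasFDerivAt_prodMk_left x t)
  have hP : AnalyticAt ℂ P 0 := by
    have : AnalyticAt ℂ (fun z => fun i : Fin d =>
        (1 / 2 : ℂ) * fderiv ℂ g z (EuclideanSpace.single i 1, 0)) 0 := by
      rw [analyticAt_pi_iff]
      intro i
      exact analyticAt_const.mul (((ContinuousLinearMap.apply ℂ ℂ
        ((EuclideanSpace.single i 1, 0) : Cd d × ℂ)).analyticAt _).fun_comp hg.fderiv)
    exact ((PiLp.continuousLinearEquiv 2 ℂ fun _ : Fin d => ℂ).symm.analyticAt _).fun_comp this
  have hcont : Filter.Tendsto (fun x : Cd d => (x, (0 : ℂ))) (𝓝 0) (𝓝 0) := by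
    have : Continuous fun x : Cd d => (x, (0 : ℂ)) := by fun_prop
    exact this.tendsto 0
  have hP0 : ∀ᶠ x : Cd d in 𝓝 0, P (x, 0) = x := by
    filter_upwards [hg0.eventually_nhds, hcont.eventually hg.eventually_analyticAt] with x hx hx'
    have h1 := (hslice hx').congr_of_eventuallyEq (hx.mono fun _ h => h.symm)
    have h2 : HasFDerivAt (fun x : Cd d => ∑ i, x i ^ 2)
        (∑ i, (2 * x i) • (EuclideanSpace.proj i : Cd d →L[ℂ] ℂ)) x := by
      refine HasFDerivAt.fun_sum fun i _ => ?_
      simpa using (EuclideanSpace.proj (𝕜 := ℂ) i : Cd d →L[ℂ] ℂ).hasFDerivAt.pow 2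
    have h3 := h1.unique h2
    ext i
    have h4 := congrArg (fun T => T (EuclideanSpace.single i 1)) h3
    simp at h4
    simp [P, h4]
  have hPd : HasFDerivAt (fun x => P (x, 0)) ((1 : ℂ) • ContinuousLinearMap.id ℂ (Cd d)) 0 := by
    rw [one_smul]
    exact (hasFDerivAt_id _).congr_of_eventuallyEq hP0
  obtain ⟨Φ, h0, hsub, hΦ, -, hΦs⟩ :=
    exists_openPartialHomeomorph_prod hP one_ne_zero hPd hg.eventually_analyticAt
  have hΦ0 : Φ 0 = 0 := by rw [hΦ]; exact Prod.ext hP0.self_of_nhds rfl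
  have ht0 : (0 : Cd d × ℂ) ∈ Φ.target := hΦ0 ▸ Φ.map_source h0
  have hΦs0 : Φ.symm 0 = 0 := by
    conv_lhs => rw [← hΦ0]
    exact Φ.left_inv h0
  have hin : AnalyticAt ℂ (fun t : ℂ => ((0 : Cd d), t)) 0 := analyticAt_const.prod analyticAt_id
  refine ⟨fun t => (Φ.symm (0, t)).1, ?_, ?_, ?_⟩
  · exact analyticAt_fst.fun_comp (AnalyticAt.fun_comp (g := Φ.symm) (hΦs 0 ht0) hin)
  · exact congrArg Prod.fst hΦs0
  · filter_upwards [hin.continuousAt.eventually_mem (Φ.open_target.mem_nhds ht0)] with t ht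
    have hz := Φ.map_target ht
    have hzt := Φ.right_inv ht
    rw [hΦ] at hzt
    set z := Φ.symm (0, t)
    have hz1 : P z = 0 := congrArg Prod.fst hzt
    have hz2 : z.2 = t := congrArg Prod.snd hzt
    have hze : z = (z.1, t) := Prod.ext rfl hz2
    have han : AnalyticAt ℂ g (z.1, t) := hze ▸ hsub hz
    refine (hslice han).congr_fderiv ?_
    rw [← hze]
    refine ContinuousLinearMap.coe_injective
      ((EuclideanSpace.basisFun (Fin d) ℂ).toBasis.ext fun i => ?_)
    have hi := congrArg (fun x : Cd d => x i) hz1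
    simpa [P] using hi

/-- An analytic deformation of `∑ xᵢ²` with critical points on the axis is a function of the
parameter plus an analytic family of quadratic forms. -/
theorem exists_analyticAt_quadratic {h : Cd d × ℂ → ℂ} (hh : AnalyticAt ℂ h 0)
    (hcrit : ∀ᶠ t in 𝓝 0, HasFDerivAt (fun x => h (x, t)) (0 : Cd d →L[ℂ] ℂ) 0)
    (hh0 : ∀ᶠ x : Cd d in 𝓝 0, h (x, 0) = ∑ i, x i ^ 2) :
    ∃ M : Cd d × ℂ → Matrix (Fin d) (Fin d) ℂ, (∀ i j, AnalyticAt ℂ (fun z => M z i j) 0) ∧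
      M 0 = 1 ∧ (∀ z, (M z).transpose = M z) ∧
      ∀ᶠ z in 𝓝 0, h z = h (0, z.2) + ∑ i, ∑ j, M z i j * (z.1 i * z.1 j) := by
  -- Dividing twice by `x` leaves a bilinear form `R`. The intermediate linear term `Q (0, t)` is
  -- the `x`-derivative of `h` at `(0, t)`, which vanishes by `hcrit`.
  obtain ⟨Q, hQ, hQh⟩ := exists_analyticAt_eq_add_apply_fst hh
  obtain ⟨R, hR, hRQ⟩ := exists_analyticAt_eq_add_apply_fst hQ
  have hax : Filter.Tendsto (fun t : ℂ => ((0 : Cd d), t)) (𝓝 0) (𝓝 0) := by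
    have : Continuous fun t : ℂ => ((0 : Cd d), t) := by fun_prop
    exact this.tendsto 0
  have hQ0 : ∀ᶠ t in 𝓝 (0 : ℂ), Q (0, t) = 0 := by
    filter_upwards [hcrit, hax.eventually hQh.eventually_nhds,
      hax.eventually hQ.eventually_analyticAt] with t ht hth htQ
    have hin : HasFDerivAt (fun x : Cd d => (x, t)) (ContinuousLinearMap.inl ℂ (Cd d) ℂ) 0 :=
      hasFDerivAt_prodMk_left 0 t
    have hQd : HasFDerivAt (fun x : Cd d => Q (x, t)) _ 0 :=
      HasFDerivAt.comp (f := fun x : Cd d => (x, t)) 0 htQ.differentiableAt.hasFDerivAt hin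
    have h1 := (hQd.clm_apply (hasFDerivAt_id (0 : Cd d))).const_add (h (0, t))
    have h2 := ht.congr_of_eventuallyEq
      ((hin.continuousAt.eventually hth).mono fun _ h => h.symm)
    have h3 := h1.unique h2
    ext v
    simpa using congrArg (fun T => T v) h3
  have hhR : ∀ᶠ z in 𝓝 (0 : Cd d × ℂ), h z = h (0, z.2) + R z z.1 z.1 := by
    have hsnd : Filter.Tendsto (fun z : Cd d × ℂ => z.2) (𝓝 0) (𝓝 0) := continuous_snd.tendsto 0
    filter_upwards [hQh, hRQ, hsnd.eventually hQ0] with z h1 h2 h3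
    rw [h1, h2, h3, zero_add]
  let b : Fin d → Cd d := fun i => EuclideanSpace.single i 1
  -- The form `R z` need not be symmetric; averaging it with its transpose keeps its values on the
  -- diagonal.
  have hsum : ∀ (B : Cd d →L[ℂ] Cd d →L[ℂ] ℂ) (x : Cd d),
      B x x = ∑ i, ∑ j, (1 / 2 * (B (b i) (b j) + B (b j) (b i))) * (x i * x j) := by
    intro B x
    have hx : x = ∑ i, x i • b i := by
      simpa [b] using ((EuclideanSpace.basisFun (Fin d) ℂ).sum_repr x).symm
    have hBx : B x x = ∑ i, ∑ j, B (b i) (b j) * (x i * x j) := by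
      conv_lhs => rw [hx]
      simp only [map_sum, map_smul, sum_apply, smul_apply, smul_eq_mul,
        Finset.mul_sum]
      refine Finset.sum_comm.trans (Finset.sum_congr rfl fun i _ => Finset.sum_congr rfl
        fun j _ => by ring)
    have hBx' : B x x = ∑ i, ∑ j, B (b j) (b i) * (x i * x j) := by
      rw [hBx, Finset.sum_comm]
      exact Finset.sum_congr rfl fun i _ => Finset.sum_congr rfl fun j _ => by ring
    have : B x x = 1 / 2 * (B x x + B x x) := by ring
    rw [this]
    nth_rewrite 1 [hBx]
    rw [hBx']
    simp only [← Finset.sum_add_distrib, Finset.mul_sum]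
    exact Finset.sum_congr rfl fun i _ => Finset.sum_congr rfl fun j _ => by ring
  -- Evaluating `h` at `(s • v, 0)` and cancelling `s ^ 2` determines `R (s • v, 0) v v` for small
  -- `s ≠ 0`; continuity gives `s = 0`.
  have hR0 : ∀ v : Cd d, R 0 v v = ∑ i, v i ^ 2 := by
    intro v
    have hs : Filter.Tendsto (fun s : ℂ => s • v) (𝓝 0) (𝓝 0) := by
      have : Continuous fun s : ℂ => s • v := by fun_prop
      simpa using this.tendsto 0
    have hs' : Filter.Tendsto (fun s : ℂ => (s • v, (0 : ℂ))) (𝓝 0) (𝓝 0) :=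
      hs.prodMk_nhds tendsto_const_nhds
    have hlim : Filter.Tendsto (fun s : ℂ => R (s • v, 0) v v) (𝓝[≠] 0) (𝓝 (R 0 v v)) := by
      have h1 : Filter.Tendsto (fun s : ℂ => R (s • v, 0)) (𝓝 0) (𝓝 (R 0)) :=
        hR.continuousAt.tendsto.comp hs'
      have h2 := ((ContinuousLinearMap.apply ℂ (Cd d →L[ℂ] ℂ) v).continuous.tendsto _).comp h1
      have h3 := ((ContinuousLinearMap.apply ℂ ℂ v).continuous.tendsto _).comp h2
      exact h3.mono_left nhdsWithin_le_nhds
    have hconst : ∀ᶠ s in 𝓝[≠] (0 : ℂ), R (s • v, 0) v v = ∑ i, v i ^ 2 := by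
      filter_upwards [nhdsWithin_le_nhds (hs.eventually hh0),
        nhdsWithin_le_nhds (hs'.eventually hhR), self_mem_nhdsWithin] with s h1 h2 hsne
      have h00 : h (0, 0) = 0 := by simpa using hh0.self_of_nhds
      rw [h1, h00] at h2
      simp only [PiLp.smul_apply, smul_eq_mul, mul_pow, ← Finset.mul_sum, map_smul,
        smul_apply, zero_add] at h2
      have hs2 : s ^ 2 ≠ 0 := pow_ne_zero 2 hsne
      refine mul_left_cancel₀ hs2 ?_
      rw [h2]; ring
    exact tendsto_nhds_unique hlim (tendsto_const_nhds.congr' (hconst.mono fun _ h => h.symm))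
  refine ⟨fun z => Matrix.of fun i j => 1 / 2 * (R z (b i) (b j) + R z (b j) (b i)), ?_, ?_, ?_, ?_⟩
  · have hentry : ∀ i j, AnalyticAt ℂ (fun z => R z (b i) (b j)) 0 := fun i j =>
      ((ContinuousLinearMap.apply ℂ ℂ (b j)).analyticAt _).fun_comp
        (((ContinuousLinearMap.apply ℂ (Cd d →L[ℂ] ℂ) (b i)).analyticAt _).fun_comp hR)
    exact fun i j => analyticAt_const.mul ((hentry i j).add (hentry j i))
  · ext i j
    -- Polarization recovers the symmetrized matrix at the origin from the quadratic form `hR0`.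
    have e : R 0 (b i) (b j) + R 0 (b j) (b i) =
        R 0 (b i + b j) (b i + b j) - R 0 (b i) (b i) - R 0 (b j) (b j) := by
      simp only [map_add, add_apply]; ring
    have hb : ∀ i l, b i l = if l = i then 1 else 0 := fun i l => by
      simp [b]
    simp only [Matrix.of_apply, e, hR0, PiLp.add_apply, hb, ← Finset.sum_sub_distrib,
      Matrix.one_apply]
    have : ∀ l : Fin d, (((if l = i then (1 : ℂ) else 0) + if l = j then 1 else 0) ^ 2 -
        (if l = i then 1 else 0) ^ 2 - (if l = j then 1 else 0) ^ 2) =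
        if l = i then (if i = j then 2 else 0) else 0 := by
      intro l
      by_cases h1 : l = i
      · subst h1
        by_cases h2 : l = j
        · simp only [h2, if_true]; norm_num
        · simp [h2]
      · simp [h1]
    simp only [this]
    simp
  · intro z
    ext i j
    simp only [Matrix.transpose_apply, Matrix.of_apply]; ring
  · filter_upwards [hhR] with z hz
    rw [hz, hsum]
    rfl

/-- This is `(Sx)ᵀ(Sx) = xᵀSᵀSx` with `Sᵀ = S`; it turns a square root of the matrix into
coordinates that diagonalize the form. -/
theorem sum_sq_mulVec_of_symmetric {ι R : Type*} [Fintype ι] [CommRing R] {S : Matrix ι ι R}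
    (hS : S.transpose = S) (x : ι → R) :
    ∑ i, (∑ j, S i j * x j) ^ 2 = ∑ i, ∑ j, (S * S) i j * (x i * x j) := by
  have hS' : ∀ i j, S i j = S j i := fun i j => congrFun (congrFun hS j) i
  simp only [sq, Matrix.mul_apply, Finset.sum_mul, Finset.mul_sum]
  rw [Finset.sum_comm]
  refine Finset.sum_congr rfl fun j _ => ?_
  rw [Finset.sum_comm]
  refine Finset.sum_congr rfl fun k _ => Finset.sum_congr rfl fun i _ => ?_
  rw [hS' j i]; ring

/-- The normal form `∑ xᵢ² = t^{l+1}` of an analytic one-parameter deformation of `∑ xᵢ²` whose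
critical value is not constant. -/
theorem exists_normal_form {g : Cd d × ℂ → ℂ} (hg : AnalyticAt ℂ g 0)
    (hg0 : ∀ᶠ x : Cd d in 𝓝 0, g (x, 0) = ∑ i, x i ^ 2)
    {ξ : ℂ → Cd d} (hξ : AnalyticAt ℂ ξ 0) (hξ0 : ξ 0 = 0)
    (hcrit : ∀ᶠ t in 𝓝 0, HasFDerivAt (fun x => g (x, t)) (0 : Cd d →L[ℂ] ℂ) (ξ t))
    (hne : ¬ ∀ᶠ t in 𝓝 0, g (ξ t, t) = 0) :
    ∃ (l : ℕ) (Φ : OpenPartialHomeomorph (Cd d × ℂ) (Cd d × ℂ)),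
      0 ∈ Φ.source ∧ Φ 0 = 0 ∧ AnalyticOnNhd ℂ Φ Φ.source ∧
      AnalyticOnNhd ℂ Φ.symm Φ.target ∧ (∀ z, (Φ z).2 = z.2) ∧
      ∃ u : Cd d × ℂ → ℂ, AnalyticOnNhd ℂ u Φ.source ∧
        ∀ z ∈ Φ.source, u z ≠ 0 ∧ g z = u z * ((∑ i, (Φ z).1 i ^ 2) - (Φ z).2 ^ (l + 1)) := by
  have hξs : AnalyticAt ℂ (fun z : Cd d × ℂ => ξ z.2) 0 :=
    AnalyticAt.fun_comp (f := fun z : Cd d × ℂ => z.2) hξ analyticAt_snd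
  have hsh : AnalyticAt ℂ (fun z : Cd d × ℂ => (z.1 + ξ z.2, z.2)) 0 :=
    (analyticAt_fst.add hξs).prod analyticAt_snd
  have hsh' : AnalyticAt ℂ (fun z : Cd d × ℂ => (z.1 - ξ z.2, z.2)) 0 :=
    (analyticAt_fst.sub hξs).prod analyticAt_snd
  have hsh0 : ((0 : Cd d × ℂ).1 + ξ (0 : Cd d × ℂ).2, (0 : Cd d × ℂ).2) = 0 := by simp [hξ0]
  have hsh0' : ((0 : Cd d × ℂ).1 - ξ (0 : Cd d × ℂ).2, (0 : Cd d × ℂ).2) = 0 := by simp [hξ0]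
  have hsht : Filter.Tendsto (fun z : Cd d × ℂ => (z.1 - ξ z.2, z.2)) (𝓝 0) (𝓝 0) := by
    have := hsh'.continuousAt.tendsto
    rwa [hsh0'] at this
  -- Translation by `ξ` moves the critical arc onto the `t`-axis.
  let h : Cd d × ℂ → ℂ := fun z => g (z.1 + ξ z.2, z.2)
  have hh : AnalyticAt ℂ h 0 :=
    AnalyticAt.fun_comp (f := fun z : Cd d × ℂ => (z.1 + ξ z.2, z.2)) (by rwa [hsh0]) hsh
  have hhcrit : ∀ᶠ t in 𝓝 0, HasFDerivAt (fun x => h (x, t)) (0 : Cd d →L[ℂ] ℂ) 0 := by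
    filter_upwards [hcrit] with t ht
    have := (hasFDerivAt_comp_add_right (f := fun x => g (x, t)) (f' := (0 : Cd d →L[ℂ] ℂ))
      (x := 0) (ξ t)).2 (by rwa [zero_add])
    exact this
  obtain ⟨M, hM, hM0, hMs, hMh⟩ := exists_analyticAt_quadratic hh hhcrit
    (by simpa [h, hξ0] using hg0)
  have hc : AnalyticAt ℂ (fun t => g (ξ t, t)) 0 :=
    AnalyticAt.fun_comp (f := fun t => (ξ t, t)) (by rw [hξ0]; exact hg) (hξ.prod analyticAt_id)
  -- `m` is the vanishing order of the critical value at `0`. It is positive because `g (0, 0) = 0`,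
  -- hence of the form `l + 1`.
  obtain ⟨m, e, he, he0, hce⟩ := hc.exists_eventuallyEq_pow_smul_nonzero_iff.2 hne
  have hm : m ≠ 0 := by
    rintro rfl
    have h1 := hce.self_of_nhds
    have h2 : g (0, 0) = 0 := by simpa using hg0.self_of_nhds
    simp only [hξ0, h2, pow_zero, one_smul] at h1
    exact he0 h1.symm
  obtain ⟨l, rfl⟩ := Nat.exists_eq_succ_of_ne_zero hm
  have hes : AnalyticAt ℂ (fun z : Cd d × ℂ => e z.2) 0 :=
    AnalyticAt.fun_comp (f := fun z : Cd d × ℂ => z.2) he analyticAt_snd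
  -- Factoring `-e` out of `g` leaves the quadratic form with matrix `-M / e`. The factor `e 0`
  -- normalizes the matrix to `1` at the origin, as the square root requires; `γ ^ 2 = -(e 0)⁻¹`
  -- restores the constant.
  obtain ⟨S, hS, hS0, hSS⟩ := exists_analyticAt_symmetric_sqrt
    (N := fun z => (e 0 / e z.2) • M z) (p := (0 : Cd d × ℂ))
    (fun i j => (analyticAt_const.div hes he0).mul (hM i j))
    (by simp [hM0, he0]) (fun z => by rw [Matrix.transpose_smul, hMs])
  obtain ⟨γ, hγ⟩ := IsAlgClosed.exists_pow_nat_eq (-(e 0)⁻¹) two_pos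
  have hγ0 : γ ≠ 0 := by
    rintro rfl
    simp [he0] at hγ
  let T : Cd d × ℂ → Cd d := fun z => WithLp.toLp 2 fun i => γ * ∑ j, S z i j * z.1 j
  have hcoord : ∀ j, AnalyticAt ℂ (fun z : Cd d × ℂ => z.1 j) 0 := fun j =>
    ((EuclideanSpace.proj (𝕜 := ℂ) j : Cd d →L[ℂ] ℂ).analyticAt _).fun_comp analyticAt_fst
  have hT : AnalyticAt ℂ T 0 := by
    have : AnalyticAt ℂ (fun z : Cd d × ℂ => fun i : Fin d => γ * ∑ j, S z i j * z.1 j) 0 := by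
      rw [analyticAt_pi_iff]
      exact fun i => analyticAt_const.mul
        (Finset.analyticAt_fun_sum _ fun j _ => (hS i j).mul (hcoord j))
    exact ((PiLp.continuousLinearEquiv 2 ℂ fun _ : Fin d => ℂ).symm.analyticAt _).fun_comp this
  -- At `x = 0` the derivative of `S` is multiplied by `x = 0`, so only `γ • S 0 = γ • 1`
  -- contributes.
  have hTd : HasFDerivAt (fun x : Cd d => T (x, 0)) (γ • ContinuousLinearMap.id ℂ (Cd d)) 0 := by
    rw [← hasFDerivWithinAt_univ, hasFDerivWithinAt_euclidean]
    intro i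
    rw [hasFDerivWithinAt_univ]
    have hterm : ∀ j, HasFDerivAt (fun x : Cd d => S (x, 0) i j * x j)
        (S 0 i j • (EuclideanSpace.proj j : Cd d →L[ℂ] ℂ)) 0 := by
      intro j
      have h1 : HasFDerivAt (fun x : Cd d => S (x, 0) i j) _ 0 :=
        HasFDerivAt.comp (f := fun x : Cd d => (x, (0 : ℂ))) 0
          (hS i j).differentiableAt.hasFDerivAt (hasFDerivAt_prodMk_left 0 0)
      refine (h1.mul (EuclideanSpace.proj (𝕜 := ℂ) j : Cd d →L[ℂ] ℂ).hasFDerivAt).congr_fderiv ?_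
      ext v
      simp [Prod.mk_zero_zero]
    refine ((HasFDerivAt.fun_sum fun j (_ : j ∈ Finset.univ) => hterm j).const_mul
      γ).congr_fderiv ?_
    ext v
    simp only [smul_apply, sum_apply, hS0, PiLp.proj_apply, Matrix.one_apply,
      smul_eq_mul, ite_mul, one_mul, zero_mul, Finset.sum_ite_eq, Finset.mem_univ, if_true]
    simp
  have hP : AnalyticAt ℂ (fun z : Cd d × ℂ => T (z.1 - ξ z.2, z.2)) 0 :=
    AnalyticAt.fun_comp (f := fun z : Cd d × ℂ => (z.1 - ξ z.2, z.2)) (by rwa [hsh0']) hsh'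
  have hsnd : Filter.Tendsto (fun z : Cd d × ℂ => z.2) (𝓝 0) (𝓝 0) := continuous_snd.tendsto 0
  have hN : ∀ᶠ z : Cd d × ℂ in 𝓝 0, AnalyticAt ℂ (fun z : Cd d × ℂ => -e z.2) z ∧
      -e z.2 ≠ 0 ∧ g z = -e z.2 *
        ((∑ i, (T (z.1 - ξ z.2, z.2)) i ^ 2) - z.2 ^ (l + 1)) := by
    filter_upwards [hes.neg.eventually_analyticAt, hsnd.eventually hce,
      hsnd.eventually (he.continuousAt.eventually_ne he0), hsht.eventually hMh,
      hsht.eventually hSS] with z h2 h3 h4 h5 h6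
    refine ⟨h2, neg_ne_zero.2 h4, ?_⟩
    have h7 : ∑ i, (T (z.1 - ξ z.2, z.2)) i ^ 2 = γ ^ 2 * (e 0 / e z.2 *
        ∑ i, ∑ j, M (z.1 - ξ z.2, z.2) i j * ((z.1 - ξ z.2) i * (z.1 - ξ z.2) j)) := by
      simp only [T, mul_pow, ← Finset.mul_sum]
      rw [sum_sq_mulVec_of_symmetric h6.1, h6.2]
      simp only [Matrix.smul_apply, smul_eq_mul, Finset.mul_sum, mul_assoc]
    have h8 : g z = g (ξ z.2, z.2) +
        ∑ i, ∑ j, M (z.1 - ξ z.2, z.2) i j * ((z.1 - ξ z.2) i * (z.1 - ξ z.2) j) := by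
      simpa [h] using h5
    rw [h7, h8, h3, hγ, smul_eq_mul]
    generalize ∑ i, ∑ j, M (z.1 - ξ z.2, z.2) i j * ((z.1 - ξ z.2) i * (z.1 - ξ z.2) j) = q
    simp only [Nat.succ_eq_add_one]
    field_simp
    ring
  obtain ⟨Φ, hΦ0, hΦN, hΦ, hΦa, hΦs⟩ := exists_openPartialHomeomorph_prod hP hγ0
    (by simpa [hξ0] using hTd) hN
  refine ⟨l, Φ, hΦ0, ?_, hΦa, hΦs, fun z => by rw [hΦ],
    fun z => -e z.2, fun z hz => (hΦN hz).1, fun z hz => ⟨(hΦN hz).2.1, ?_⟩⟩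
  · rw [hΦ]
    refine Prod.ext ?_ rfl
    ext i
    simp [T, hξ0]
  · rw [hΦ]
    exact (hΦN hz).2.2

end NormalForm

/-! ### Singular points and `A_l` type under isomorphism of germs. -/

section Germs

variable {E H M E' H' M' : Type*}
  [NormedAddCommGroup E] [NormedSpace ℂ E] [TopologicalSpace H]
  [TopologicalSpace M] [ChartedSpace H M]
  [NormedAddCommGroup E'] [NormedSpace ℂ E'] [TopologicalSpace H']
  [TopologicalSpace M'] [ChartedSpace H' M']
  {I' : ModelWithCorners ℂ E' H'} {I : ModelWithCorners ℂ E H}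

/-- Singular points of hypersurfaces pull back to singular points. -/
theorem IsSingularZero.of_eventuallyEq_mul_comp {F : M → ℂ} {G : M' → ℂ} {φ : M → M'} {u : M → ℂ}
    {p : M} (hG : IsSingularZero I' G (φ p)) (hGd : MDifferentiableAt I' 𝓘(ℂ, ℂ) G (φ p))
    (hφ : MDifferentiableAt I I' φ p) (hu : MDifferentiableAt I 𝓘(ℂ, ℂ) u p)
    (h : F =ᶠ[𝓝 p] fun z => u z * G (φ z)) : IsSingularZero I F p := by
  refine ⟨h.self_of_nhds.trans (by simp only [hG.1, mul_zero]), ?_⟩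
  have h1 := hGd.hasMFDerivAt.comp p hφ.hasMFDerivAt
  have h2 := (hu.hasMFDerivAt.mul h1).congr_of_eventuallyEq h
  refine h2.mfderiv.trans ?_
  rw [hG.2]
  let A : E →L[ℂ] E' := mfderiv I I' φ p
  let B : E →L[ℂ] ℂ := mfderiv I 𝓘(ℂ, ℂ) u p
  change u p • (0 : E' →L[ℂ] ℂ).comp A + G (φ p) • B = 0
  rw [hG.1]
  ext v
  simp

/-- An isomorphism of germs of hypersurfaces identifies their singular points. -/
theorem IsGermIso.isSingularZero_iff {φ : OpenPartialHomeomorph M M'} {F : M → ℂ} {p : M}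
    {G : M' → ℂ} {q : M'} (h : IsGermIso I I' φ F p G q) (hF : MDifferentiableAt I 𝓘(ℂ, ℂ) F p)
    (hG : MDifferentiableAt I' 𝓘(ℂ, ℂ) G q) : IsSingularZero I F p ↔ IsSingularZero I' G q := by
  obtain ⟨hp, rfl, hφ, hφs, u, hu, hFu⟩ := h
  have hω : (ω : WithTop ℕ∞) ≠ 0 := by simp
  have hq := φ.map_source hp
  have hφp := (hφ.contMDiffAt (φ.open_source.mem_nhds hp)).mdifferentiableAt hω
  have hφq := (hφs.contMDiffAt (φ.open_target.mem_nhds hq)).mdifferentiableAt hω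
  have hup := (hu.contMDiffAt (φ.open_source.mem_nhds hp)).mdifferentiableAt hω
  have hinv := φ.left_inv hp
  constructor
  · intro hs
    have hui : MDifferentiableAt I 𝓘(ℂ, ℂ) (fun z => (u z)⁻¹) p := by
      have : DifferentiableAt ℂ (fun z : ℂ => z⁻¹) (u p) := differentiableAt_inv (hFu p hp).1
      exact this.mdifferentiableAt.comp p hup
    -- The inverse isomorphism reads `G = (u ∘ φ.symm)⁻¹ * (F ∘ φ.symm)`.
    refine IsSingularZero.of_eventuallyEq_mul_comp (G := F) (φ := φ.symm)
      (u := fun w => (u (φ.symm w))⁻¹) (by rwa [hinv]) (by rwa [hinv]) hφq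
      (MDifferentiableAt.comp (φ p) (g := fun z => (u z)⁻¹) (by rwa [hinv]) hφq) ?_
    filter_upwards [φ.open_target.mem_nhds hq] with w hw
    have h1 := hFu _ (φ.map_target hw)
    rw [h1.2, φ.right_inv hw, inv_mul_cancel_left₀ h1.1]
  · intro hs
    refine hs.of_eventuallyEq_mul_comp hG hφp hup ?_
    filter_upwards [φ.open_source.mem_nhds hp] with z hz using (hFu z hz).2

/-- The hypersurface `∑ xᵢ² = t^{l+1}` is singular at the origin if and only if `l ≥ 1`. -/
theorem isSingularZero_normal_form_iff (d l : ℕ) :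
    IsSingularZero 𝓘(ℂ, Cd d × ℂ) (fun w : Cd d × ℂ => (∑ i, w.1 i ^ 2) - w.2 ^ (l + 1)) 0 ↔
      1 ≤ l := by
  -- The convention `0 ^ 0 = 1` covers both cases: the differential is nonzero for `l = 0` and zero
  -- for `l ≥ 1`.
  have hd : HasFDerivAt (fun w : Cd d × ℂ => (∑ i, w.1 i ^ 2) - w.2 ^ (l + 1))
      (-(((l + 1 : ℕ) : ℂ) * 0 ^ l) • ContinuousLinearMap.snd ℂ (Cd d) ℂ) 0 := by
    have h1 : ∀ i, HasFDerivAt (fun w : Cd d × ℂ => w.1 i ^ 2) (0 : Cd d × ℂ →L[ℂ] ℂ) 0 := by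
      intro i
      have hi : HasFDerivAt (fun w : Cd d × ℂ => w.1 i) ((EuclideanSpace.proj (𝕜 := ℂ) i :
          Cd d →L[ℂ] ℂ).comp (ContinuousLinearMap.fst ℂ (Cd d) ℂ)) 0 :=
        ((EuclideanSpace.proj (𝕜 := ℂ) i : Cd d →L[ℂ] ℂ).comp
          (ContinuousLinearMap.fst ℂ (Cd d) ℂ)).hasFDerivAt
      refine (hi.pow 2).congr_fderiv ?_
      ext <;> simp
    have h2 : HasFDerivAt (fun w : Cd d × ℂ => w.2 ^ (l + 1)) _ 0 :=
      (hasFDerivAt_snd (𝕜 := ℂ) (p := (0 : Cd d × ℂ))).pow (l + 1)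
    refine ((HasFDerivAt.fun_sum fun i (_ : i ∈ Finset.univ) => h1 i).sub h2).congr_fderiv ?_
    ext <;> simp
  unfold IsSingularZero
  rw [mfderiv_eq_fderiv, hd.fderiv]
  change _ ∧ -(((l + 1 : ℕ) : ℂ) * 0 ^ l) • ContinuousLinearMap.snd ℂ (Cd d) ℂ = 0 ↔ _
  constructor
  · rintro ⟨-, h⟩
    by_contra hl
    obtain rfl : l = 0 := by omega
    have := congrArg (fun T : Cd d × ℂ →L[ℂ] ℂ => T (0, 1)) h
    simp at this
  · intro hl
    have : l ≠ 0 := by omega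
    refine ⟨by simp, by ext <;> simp [this]⟩

theorem mdifferentiableAt_normal_form (d l : ℕ) (p : Cd d × ℂ) :
    MDifferentiableAt 𝓘(ℂ, Cd d × ℂ) 𝓘(ℂ, ℂ)
      (fun w : Cd d × ℂ => (∑ i, w.1 i ^ 2) - w.2 ^ (l + 1)) p := by
  refine DifferentiableAt.mdifferentiableAt ?_
  fun_prop

/-- Over `ℂ`, the equations `∑ xᵢ² = t^{l+1}` and `∑ xᵢ² + z^{l+1} = 0` define isomorphic germs. -/
theorem IsGermIso.isTypeA {d l : ℕ} {φ : OpenPartialHomeomorph M (Cd d × ℂ)} {F : M → ℂ} {p : M}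
    (hl : 1 ≤ l) (h : IsGermIso I 𝓘(ℂ, Cd d × ℂ) φ F p
      (fun w => (∑ i, w.1 i ^ 2) - w.2 ^ (l + 1)) 0) : IsTypeA l d I F p := by
  -- The substitution `z = ζ * t` with `ζ ^ (l + 1) = -1` gives `z ^ (l + 1) = -t ^ (l + 1)`.
  obtain ⟨ζ, hζ⟩ := IsAlgClosed.exists_pow_nat_eq (-1 : ℂ) (Nat.succ_pos l)
  have hζ0 : ζ ≠ 0 := by
    rintro rfl
    simp at hζ
  let e : (Cd d × ℂ) ≃L[ℂ] (Cd d × ℂ) := (ContinuousLinearEquiv.refl ℂ (Cd d)).prodCongr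
    (ContinuousLinearEquiv.smulLeft (Units.mk0 ζ hζ0))
  have he : ∀ w, e w = (w.1, ζ * w.2) := fun w => rfl
  obtain ⟨hp, hp0, hφ, hφs, u, hu, hFu⟩ := h
  refine ⟨hl, φ.transHomeomorph e.toHomeomorph, hp, ?_, ?_, ?_, u, hu, fun z hz =>
    ⟨(hFu z hz).1, ?_⟩⟩
  · change e (φ p) = 0
    rw [hp0, map_zero]
  · exact e.contDiff.contMDiff.comp_contMDiffOn hφ
  · exact hφs.comp e.symm.contDiff.contMDiff.contMDiffOn fun w hw => hw
  · change F z = u z * ((∑ i, (e (φ z)).1 i ^ 2) + (e (φ z)).2 ^ (l + 1))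
    rw [(hFu z hz).2, he, mul_pow, hζ]
    ring

end Germs

/-! ### Local equations of the members of the linear system. -/

section LinearSystem

variable {d : ℕ} {X : Type*} [TopologicalSpace X] [ChartedSpace (Cd d) X]
  {L : X → Type*} [∀ x, AddCommGroup (L x)] [∀ x, Module ℂ (L x)]
  [∀ x, TopologicalSpace (L x)] [TopologicalSpace (Bundle.TotalSpace ℂ L)]
  [FiberBundle ℂ L] [VectorBundle ℂ ℂ L] {k : ℕ}

theorem localFun_smul (x₀ : X) (c : ℂ) (s : ∀ x, ⨂[ℂ]^k (L x)) (x : X) :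
    localFun L k x₀ (c • s) x = c * localFun L k x₀ s x := by
  simp [localFun]

theorem localFun_sum_smul {m : ℕ} (x₀ : X) (c : Fin m → ℂ) (σ : Fin m → H0 (d := d) L k) (x : X) :
    localFun L k x₀ ((∑ j, c j • σ j : H0 (d := d) L k) : ∀ x, ⨂[ℂ]^k (L x)) x =
      ∑ j, c j * localFun L k x₀ (σ j) x := by
  simp [localFun]

/-- On a line the coordinate change is multiplication by its value at `1`, so on the `k`-th tensor
power it is the `k`-th power of that scalar. This makes `Sing X_s` independent of the
trivialization. -/
theorem localFun_eq_coordChangeL_pow_mul {x₀ x₁ x : X}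
    (h₀ : x ∈ (trivializationAt ℂ L x₀).baseSet) (h₁ : x ∈ (trivializationAt ℂ L x₁).baseSet)
    (s : ∀ x, ⨂[ℂ]^k (L x)) :
    localFun L k x₁ s x =
      ((trivializationAt ℂ L x₀).coordChangeL ℂ (trivializationAt ℂ L x₁) x 1) ^ k *
        localFun L k x₀ s x := by
  set c := (trivializationAt ℂ L x₀).coordChangeL ℂ (trivializationAt ℂ L x₁) x 1 with hc
  have hlin : ∀ v : L x, (trivializationAt ℂ L x₁).linearMapAt ℂ x v =
      c * (trivializationAt ℂ L x₀).linearMapAt ℂ x v := by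
    intro v
    have h2 : (trivializationAt ℂ L x₀).coordChangeL ℂ (trivializationAt ℂ L x₁) x
        ((trivializationAt ℂ L x₀).linearMapAt ℂ x v) =
        (trivializationAt ℂ L x₁).linearMapAt ℂ x v := by
      rw [Bundle.Trivialization.coordChangeL_apply _ _ ⟨h₀, h₁⟩,
        Bundle.Trivialization.symm_linearMapAt _ h₀,
        Bundle.Trivialization.coe_linearMapAt_of_mem _ h₁]
    rw [← h2, hc, mul_comm, ← smul_eq_mul, ← map_smul, smul_eq_mul, mul_one]
  have hpow : powCoord L k x₁ x = c ^ k • powCoord L k x₀ x := by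
    refine PiTensorProduct.ext ?_
    ext v
    simp [powCoord, hlin, Finset.prod_mul_distrib]
  simp [localFun, hpow]

/-- A local equation of the total space is holomorphic. -/
theorem IsTotalSpaceEq.contMDiffAt {ν : ℂ → LinSys (d := d) L k} {p : X × ℂ} {F : X × ℂ → ℂ}
    (hF : IsTotalSpaceEq L k ν p F) :
    ContMDiffAt (𝓘(ℂ, Cd d).prod 𝓘(ℂ, ℂ)) 𝓘(ℂ, ℂ) ω F p := by
  obtain ⟨a, ⟨⟨m, σ, c, hc, ha⟩, -⟩, rfl⟩ := hF
  have hp := FiberBundle.mem_baseSet_trivializationAt ℂ L p.1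
  have h1 : ContMDiffAt (𝓘(ℂ, Cd d).prod 𝓘(ℂ, ℂ)) 𝓘(ℂ, ℂ) ω
      (fun z : X × ℂ => ∑ j, c j z.2 * localFun L k p.1 (σ j) z.1) p := by
    refine ContMDiffAt.sum fun j _ => ContMDiffAt.mul ?_ ?_
    · exact (hc j).contDiffAt.contMDiffAt.comp p contMDiffAt_snd
    · exact (((σ j).2 p.1).contMDiffAt
        ((trivializationAt ℂ L p.1).open_baseSet.mem_nhds hp)).comp p contMDiffAt_fst
  refine h1.congr_of_eventuallyEq ?_
  filter_upwards [continuousAt_snd.eventually ha] with z hz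
  rw [hz, localFun_sum_smul]

variable [ContMDiffVectorBundle ω ℂ L 𝓘(ℂ, Cd d)]

/-- The singular points of a member can be detected in any trivialization and for any
representative of the parameter. -/
theorem mem_singMember_mk {s : H0 (d := d) L k} (hs : s ≠ 0) {x₀ x : X}
    (hx : x ∈ (trivializationAt ℂ L x₀).baseSet)
    (h : IsSingularZero 𝓘(ℂ, Cd d) (localFun L k x₀ s) x) :
    x ∈ singMember L k (Projectivization.mk ℂ s hs) := by
  obtain ⟨α, hα⟩ := Projectivization.exists_smul_eq_mk_rep ℂ s hs
  have hω : (ω : WithTop ℕ∞) ≠ 0 := by simp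
  have hx' := FiberBundle.mem_baseSet_trivializationAt ℂ L x
  -- Two changes are combined in one factor: `α` passes from `s` to the chosen representative of its
  -- line, and the transition function passes from `x₀` to `x`.
  have hc : MDifferentiableAt 𝓘(ℂ, Cd d) 𝓘(ℂ, ℂ) (fun z => (α : ℂ) *
      ((trivializationAt ℂ L x₀).coordChangeL ℂ (trivializationAt ℂ L x) z 1) ^ k) x := by
    have h1 : ContMDiffAt 𝓘(ℂ, Cd d) 𝓘(ℂ, ℂ →L[ℂ] ℂ) ω (fun z =>
        ((trivializationAt ℂ L x₀).coordChangeL ℂ (trivializationAt ℂ L x) z : ℂ →L[ℂ] ℂ)) x :=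
      contMDiffAt_coordChangeL hx hx'
    have h2 : ContDiff ℂ ω (fun T : ℂ →L[ℂ] ℂ => (α : ℂ) * (T 1) ^ k) := by fun_prop
    exact (h2.contMDiff.contMDiffAt.comp x h1).mdifferentiableAt hω
  refine IsSingularZero.of_eventuallyEq_mul_comp (φ := id) h
    (((s.2 x₀).contMDiffAt ((trivializationAt ℂ L x₀).open_baseSet.mem_nhds hx)).mdifferentiableAt
      hω) mdifferentiableAt_id hc ?_
  filter_upwards [(trivializationAt ℂ L x₀).open_baseSet.mem_nhds hx,
    (trivializationAt ℂ L x).open_baseSet.mem_nhds hx'] with z h1 h2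
  have hrep : ((Projectivization.mk ℂ s hs).rep : ∀ x, ⨂[ℂ]^k (L x)) = (α : ℂ) • s := by
    rw [← hα]; rfl
  rw [memberEq, hrep, localFun_smul, localFun_eq_coordChangeL_pow_mul h1 h2, mul_assoc]
  rfl

end LinearSystem

/-! ### Local structure of the total space along the central fibre. -/

section TotalSpace

variable {d : ℕ} {X : Type*} [TopologicalSpace X] [ChartedSpace (Cd d) X]
  {L : X → Type*} [∀ x, AddCommGroup (L x)] [∀ x, Module ℂ (L x)]
  [∀ x, TopologicalSpace (L x)] [TopologicalSpace (Bundle.TotalSpace ℂ L)]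
  [FiberBundle ℂ L] [VectorBundle ℂ ℂ L] {k : ℕ}

/-- A product of an analytic chart of `X` and the identity of `ℂ`, followed by an analytic
isomorphism, is an isomorphism of germs. -/
theorem isGermIso_prod_refl_trans {χ : OpenPartialHomeomorph X (Cd d)}
    {Φ : OpenPartialHomeomorph (Cd d × ℂ) (Cd d × ℂ)} {F : X × ℂ → ℂ} {g G : Cd d × ℂ → ℂ}
    {w : X → ℂ} {u : Cd d × ℂ → ℂ} {y : X} (hy : y ∈ χ.source) (hy0 : χ y = 0)
    (hχ : ContMDiffOn 𝓘(ℂ, Cd d) 𝓘(ℂ, Cd d) ω χ χ.source)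
    (hχs : ContMDiffOn 𝓘(ℂ, Cd d) 𝓘(ℂ, Cd d) ω χ.symm χ.target)
    (hw : ContMDiffOn 𝓘(ℂ, Cd d) 𝓘(ℂ, ℂ) ω w χ.source)
    (hFw : ∀ z : X × ℂ, z.1 ∈ χ.source → w z.1 ≠ 0 ∧ F z = w z.1 * g (χ z.1, z.2))
    (hΦ0 : 0 ∈ Φ.source) (hΦ0' : Φ 0 = 0) (hΦ : AnalyticOnNhd ℂ Φ Φ.source)
    (hΦs : AnalyticOnNhd ℂ Φ.symm Φ.target) (hu : AnalyticOnNhd ℂ u Φ.source)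
    (hgu : ∀ z ∈ Φ.source, u z ≠ 0 ∧ g z = u z * G (Φ z)) :
    IsGermIso (𝓘(ℂ, Cd d).prod 𝓘(ℂ, ℂ)) 𝓘(ℂ, Cd d × ℂ)
      ((χ.prod (OpenPartialHomeomorph.refl ℂ)).trans Φ) F (y, 0) G 0 := by
  have hsrc : ∀ z, z ∈ ((χ.prod (OpenPartialHomeomorph.refl ℂ)).trans Φ).source ↔
      z.1 ∈ χ.source ∧ (χ z.1, z.2) ∈ Φ.source := by
    intro z; simp
  have htgt : ∀ z, z ∈ ((χ.prod (OpenPartialHomeomorph.refl ℂ)).trans Φ).target ↔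
      z ∈ Φ.target ∧ (Φ.symm z).1 ∈ χ.target := by
    intro z; simp
  have hpair : ContMDiffOn (𝓘(ℂ, Cd d).prod 𝓘(ℂ, ℂ)) 𝓘(ℂ, Cd d × ℂ) ω
      (fun z : X × ℂ => (χ z.1, z.2))
      ((χ.prod (OpenPartialHomeomorph.refl ℂ)).trans Φ).source :=
    (hχ.comp contMDiffOn_fst fun z hz => ((hsrc z).1 hz).1).prodMk_space contMDiffOn_snd
  refine ⟨(hsrc _).2 ⟨hy, ?_⟩, ?_, ?_, ?_, fun z => w z.1 * u (χ z.1, z.2), ?_, fun z hz => ?_⟩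
  · rw [hy0]; exact hΦ0
  · change Φ (χ y, 0) = 0
    rw [hy0]; exact hΦ0'
  · exact hΦ.contDiffOn Φ.open_source.uniqueDiffOn |>.contMDiffOn.comp hpair
      fun z hz => ((hsrc z).1 hz).2
  · have h1 : ContMDiffOn 𝓘(ℂ, Cd d × ℂ) 𝓘(ℂ, Cd d × ℂ) ω Φ.symm
        ((χ.prod (OpenPartialHomeomorph.refl ℂ)).trans Φ).target :=
      (hΦs.contDiffOn Φ.open_target.uniqueDiffOn).contMDiffOn.mono fun z hz => ((htgt z).1 hz).1
    have h2 := contDiff_fst (𝕜 := ℂ) (E := Cd d) (F := ℂ) (n := ω) |>.contMDiff.comp_contMDiffOn h1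
    have h3 := contDiff_snd (𝕜 := ℂ) (E := Cd d) (F := ℂ) (n := ω) |>.contMDiff.comp_contMDiffOn h1
    exact (hχs.comp h2 fun z hz => ((htgt z).1 hz).2).prodMk h3
  · exact (hw.comp contMDiffOn_fst fun z hz => ((hsrc z).1 hz).1).mul
      ((hu.contDiffOn Φ.open_source.uniqueDiffOn).contMDiffOn.comp hpair
        fun z hz => ((hsrc z).1 hz).2)
  · obtain ⟨h1, h2⟩ := (hsrc z).1 hz
    refine ⟨mul_ne_zero (hFw z h1).1 (hgu _ h2).1, ?_⟩
    rw [(hFw z h1).2, (hgu _ h2).2, mul_assoc]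
    rfl

variable [ContMDiffVectorBundle ω ℂ L 𝓘(ℂ, Cd d)]

/-- At an ordinary double point of the central fibre of a one-parameter family whose other fibres
are smooth, the total space has the equation `∑ xᵢ² = t^{l+1}` in suitable coordinates. -/
theorem IsTotalSpaceEq.exists_isGermIso {r : ℝ} (hr : 0 < r) {ν : ℂ → LinSys (d := d) L k}
    (hD : ∀ t ∈ Metric.ball (0 : ℂ) r, ν t ∈ discriminant L k ↔ t = 0) {y : X}
    (hy : IsOrdinaryDoublePoint d 𝓘(ℂ, Cd d) (memberEq L k (ν 0) y) y)
    {F : X × ℂ → ℂ} (hF : IsTotalSpaceEq L k ν (y, 0) F) :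
    ∃ (l : ℕ) (φ : OpenPartialHomeomorph (X × ℂ) (Cd d × ℂ)),
      IsGermIso (𝓘(ℂ, Cd d).prod 𝓘(ℂ, ℂ)) 𝓘(ℂ, Cd d × ℂ) φ F (y, 0)
        (fun w => (∑ i, w.1 i ^ 2) - w.2 ^ (l + 1)) 0 ∧ ∀ z ∈ φ.source, (φ z).2 = z.2 := by
  have hFan := hF.contMDiffAt
  obtain ⟨a, ⟨-, hlift⟩, rfl⟩ := hF
  have hω : (ω : WithTop ℕ∞) ≠ 0 := by simp
  obtain ⟨χ, hyχ, hy0, hχ, hχs, v, hv, hFv⟩ := hy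
  have hyb := FiberBundle.mem_baseSet_trivializationAt ℂ L y
  have h0t : (0 : Cd d) ∈ χ.target := hy0 ▸ χ.map_source hyχ
  have hχ0 : χ.symm 0 = y := by rw [← hy0, χ.left_inv hyχ]
  have hχs0 := hχs.contMDiffAt (χ.open_target.mem_nhds h0t)
  obtain ⟨h00, hν0⟩ := hlift.self_of_nhds
  change a 0 ≠ 0 at h00
  change ν 0 = Projectivization.mk ℂ (a 0) h00 at hν0
  obtain ⟨α, hα⟩ := Projectivization.exists_smul_eq_mk_rep ℂ (a 0) h00
  have hmem : ∀ x, localFun L k y (a 0) x = (α : ℂ)⁻¹ * memberEq L k (ν 0) y x := by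
    intro x
    have hrep : ((ν 0).rep : ∀ x, ⨂[ℂ]^k (L x)) = (α : ℂ) • a 0 := by
      rw [hν0, ← hα]; rfl
    rw [memberEq, hrep, localFun_smul, inv_mul_cancel_left₀ α.ne_zero]
  -- `v` compares the member's equation with `∑ xᵢ²`, and `α` compares the lift `a 0` with the
  -- representative of `ν 0`. Dividing by `w` makes `g (x, 0)` exactly `∑ xᵢ²`.
  let w : X → ℂ := fun x => (α : ℂ)⁻¹ * v x
  have hw : ContMDiffOn 𝓘(ℂ, Cd d) 𝓘(ℂ, ℂ) ω w χ.source := contMDiffOn_const.mul hv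
  have hw0 : ∀ x ∈ χ.source, w x ≠ 0 := fun x hx =>
    mul_ne_zero (inv_ne_zero α.ne_zero) (hFv x hx).1
  let g : Cd d × ℂ → ℂ := fun z => (w (χ.symm z.1))⁻¹ * localFun L k y (a z.2) (χ.symm z.1)
  have hFg : ∀ x ∈ χ.source, ∀ t, localFun L k y (a t) x = w x * g (χ x, t) := by
    intro x hx t
    simp only [g]
    rw [χ.left_inv hx, mul_inv_cancel_left₀ (hw0 x hx)]
  have hfst : ContMDiffAt 𝓘(ℂ, Cd d × ℂ) 𝓘(ℂ, Cd d) ω (fun z : Cd d × ℂ => z.1) 0 :=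
    contDiff_fst.contMDiff.contMDiffAt
  have hχfst : ContMDiffAt 𝓘(ℂ, Cd d × ℂ) 𝓘(ℂ, Cd d) ω (fun z : Cd d × ℂ => χ.symm z.1) 0 :=
    ContMDiffAt.comp (0 : Cd d × ℂ) (g := χ.symm) (f := fun z : Cd d × ℂ => z.1) hχs0 hfst
  have hg : AnalyticAt ℂ g 0 := by
    have hw' : ContMDiffAt 𝓘(ℂ, Cd d × ℂ) 𝓘(ℂ, ℂ) ω
        (fun z : Cd d × ℂ => (w (χ.symm z.1))⁻¹) 0 := by
      have h1 : ContMDiffAt 𝓘(ℂ, Cd d × ℂ) 𝓘(ℂ, ℂ) ω (fun z : Cd d × ℂ => w (χ.symm z.1)) 0 :=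
        ContMDiffAt.comp (0 : Cd d × ℂ) (g := w) (f := fun z : Cd d × ℂ => χ.symm z.1)
          (by
            change ContMDiffAt _ _ _ _ (χ.symm 0)
            rw [hχ0]
            exact hw.contMDiffAt (χ.open_source.mem_nhds hyχ)) hχfst
      have h2 : w (χ.symm 0) ≠ 0 := by rw [hχ0]; exact hw0 y hyχ
      exact (h1.contDiffAt.inv h2).contMDiffAt
    have hF' : ContMDiffAt 𝓘(ℂ, Cd d × ℂ) 𝓘(ℂ, ℂ) ω
        (fun z : Cd d × ℂ => localFun L k y (a z.2) (χ.symm z.1)) 0 := by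
      refine ContMDiffAt.comp (0 : Cd d × ℂ)
        (g := fun z : X × ℂ => localFun L k y (a z.2) z.1)
        (f := fun z : Cd d × ℂ => (χ.symm z.1, z.2)) ?_
        (hχfst.prodMk contDiff_snd.contMDiff.contMDiffAt)
      change ContMDiffAt _ _ _ _ (χ.symm 0, 0)
      rw [hχ0]
      exact hFan
    exact (hw'.mul hF').contDiffAt.analyticAt
  have hg0 : ∀ᶠ x : Cd d in 𝓝 0, g (x, 0) = ∑ i, x i ^ 2 := by
    filter_upwards [χ.open_target.mem_nhds h0t] with x hx
    have hx' := χ.map_target hx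
    simp only [g]
    rw [hmem, (hFv _ hx').2, χ.right_inv hx, ← mul_assoc (α : ℂ)⁻¹,
      inv_mul_cancel_left₀ (hw0 _ hx')]
  obtain ⟨ξ, hξ, hξ0, hcrit⟩ := exists_analyticAt_critical_arc hg hg0
  -- An identically vanishing critical value would make `χ.symm (ξ t)` a singular point of
  -- `X_{ν(t)}` for all small `t`. Then `hD` would force `t = 0` on a whole neighbourhood of `0`.
  have hne : ¬ ∀ᶠ t in 𝓝 0, g (ξ t, t) = 0 := by
    intro hzero
    have hξt : Filter.Tendsto ξ (𝓝 0) (𝓝 0) := by simpa [hξ0] using hξ.continuousAt.tendsto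
    have hb : ∀ᶠ x : Cd d in 𝓝 0, χ.symm x ∈ (trivializationAt ℂ L y).baseSet :=
      hχs0.continuousAt.eventually_mem
        (hχ0.symm ▸ (trivializationAt ℂ L y).open_baseSet.mem_nhds hyb)
    have hall : ∀ᶠ t in 𝓝 (0 : ℂ), t = 0 := by
      filter_upwards [hzero, hcrit, hξt.eventually hb, hξt.eventually_mem
        (χ.open_target.mem_nhds h0t), hlift, Metric.ball_mem_nhds 0 hr] with t h1 h2 h3 h4 h5 h6
      obtain ⟨hat, hνt⟩ := h5
      refine (hD t h6).1 ⟨χ.symm (ξ t), ?_⟩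
      rw [hνt]
      refine mem_singMember_mk hat h3 ?_
      have hx := χ.map_target h4
      have hx' := χ.right_inv h4
      refine IsSingularZero.of_eventuallyEq_mul_comp (I' := 𝓘(ℂ, Cd d))
        (G := fun x => g (x, t)) (φ := χ) (u := w) ?_ ?_
        ((hχ.contMDiffAt (χ.open_source.mem_nhds hx)).mdifferentiableAt hω)
        ((hw.contMDiffAt (χ.open_source.mem_nhds hx)).mdifferentiableAt hω) ?_
      · rw [hx']
        exact ⟨h1, by rw [mfderiv_eq_fderiv, h2.fderiv]; rfl⟩
      · rw [hx']
        exact h2.differentiableAt.mdifferentiableAt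
      · filter_upwards [χ.open_source.mem_nhds hx] with x hx using hFg x hx t
    have hpunct : ∀ᶠ t in 𝓝[≠] (0 : ℂ), t = 0 := hall.filter_mono nhdsWithin_le_nhds
    obtain ⟨t, ht, hne⟩ := (hpunct.and self_mem_nhdsWithin).exists
    exact hne ht
  obtain ⟨l, Φ, hΦ0, hΦ0', hΦ, hΦs, hΦ2, u, hu, hgu⟩ := exists_normal_form hg hg0 hξ hξ0 hcrit hne
  exact ⟨l, _, isGermIso_prod_refl_trans hyχ hy0 hχ hχs hw
    (fun z hz => ⟨hw0 z.1 hz, hFg z.1 hz z.2⟩) hΦ0 hΦ0' hΦ hΦs hu hgu, fun z _ => hΦ2 _⟩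

/-- A singular point of the total space is a singular point of the fibre through it. -/
theorem mem_singMember_of_mem_singTotalSpace {ν : ℂ → LinSys (d := d) L k} {C : Set ℂ} {p : X × ℂ}
    (hp : p ∈ singTotalSpace L k ν C) : p.1 ∈ singMember L k (ν p.2) := by
  obtain ⟨-, F, hF, hs⟩ := hp
  have hω : (ω : WithTop ℕ∞) ≠ 0 := by simp
  have hFd := hF.contMDiffAt.mdifferentiableAt hω
  obtain ⟨a, ⟨-, hlift⟩, rfl⟩ := hF
  obtain ⟨ha, hν⟩ := hlift.self_of_nhds
  rw [hν]
  refine mem_singMember_mk ha (FiberBundle.mem_baseSet_trivializationAt ℂ L p.1) ?_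
  -- The fibre's equation is the restriction of `F` along the slice `x ↦ (x, p.2)`, so it inherits
  -- the vanishing of `F` and of its differential.
  refine IsSingularZero.of_eventuallyEq_mul_comp (φ := fun x => (x, p.2)) (u := fun _ => 1)
    hs hFd ?_ mdifferentiableAt_const (Filter.Eventually.of_forall fun z => (one_mul _).symm)
  exact mdifferentiableAt_id.prodMk mdifferentiableAt_const

end TotalSpace
end LinearSystemFamily

/-! ### The theorem. -/

open LinearSystemFamily in
theorem proposition3 (n : ℕ)
    -- a smooth complex projective variety `X` of dimension `2n`, as a complex manifold
    (X : Type*) [TopologicalSpace X] [ChartedSpace (Cd (2 * n)) X]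
    [IsManifold 𝓘(ℂ, Cd (2 * n)) ω X] [T2Space X] [CompactSpace X] [ConnectedSpace X]
    -- a holomorphic line bundle `L` on `X`
    (L : X → Type*) [∀ x, AddCommGroup (L x)] [∀ x, Module ℂ (L x)]
    [∀ x, TopologicalSpace (L x)] [TopologicalSpace (Bundle.TotalSpace ℂ L)]
    [FiberBundle ℂ L] [VectorBundle ℂ ℂ L]
    [ContMDiffVectorBundle ω ℂ L 𝓘(ℂ, Cd (2 * n))]
    -- with a very ample positive power
    (k : ℕ) (hk : 0 < k) (hL : IsVeryAmplePow (d := 2 * n) L k)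
    -- a holomorphic map `ν` from an open disk `C` to `S = |L^k|` with `ν⁻¹(D) = {0}`
    (r : ℝ) (hr : 0 < r) (ν : ℂ → LinSys (d := 2 * n) L k)
    (hν : IsHolomorphicOn L k ν (Metric.ball 0 r))
    (hD : ∀ t ∈ Metric.ball (0 : ℂ) r, ν t ∈ discriminant L k ↔ t = 0)
    -- the singularities of `Y₀ = X_{ν(0)}` are ordinary double points
    (hY₀ : ∀ y ∈ singMember L k (ν 0),
      IsOrdinaryDoublePoint (2 * n) 𝓘(ℂ, Cd (2 * n)) (memberEq L k (ν 0) y) y) :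
    -- the singular points of `Y` are singular points of `Y₀`, and are of type `A_l`, `l ≥ 1`
    (∀ p ∈ singTotalSpace L k ν (Metric.ball 0 r),
      p.2 = 0 ∧ p.1 ∈ singMember L k (ν 0) ∧
      ∃ l : ℕ, ∃ F, IsTotalSpaceEq L k ν p F ∧
        IsTypeA l (2 * n) (𝓘(ℂ, Cd (2 * n)).prod 𝓘(ℂ, ℂ)) F p) ∧
    -- at each singular point of `Y₀`, `Y` is isomorphic over `C` to `∑ xᵢ² = t^{l+1}`, `l ≥ 0`
    (∀ y ∈ singMember L k (ν 0), ∃ l : ℕ,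
      (∃ F, IsTotalSpaceEq L k ν (y, 0) F ∧
        ∃ φ : OpenPartialHomeomorph (X × ℂ) (Cd (2 * n) × ℂ),
          IsGermIso (𝓘(ℂ, Cd (2 * n)).prod 𝓘(ℂ, ℂ)) 𝓘(ℂ, Cd (2 * n) × ℂ) φ F (y, 0)
            (fun w => (∑ i, w.1 i ^ 2) - w.2 ^ (l + 1)) 0 ∧
          ∀ z ∈ φ.source, (φ z).2 = z.2) ∧
      ((y, (0 : ℂ)) ∈ singTotalSpace L k ν (Metric.ball 0 r) ↔ 1 ≤ l)) := by
  have hω : (ω : WithTop ℕ∞) ≠ 0 := by simp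
  have hsing : ∀ {y : X} {F : X × ℂ → ℂ} {l : ℕ}
      {φ : OpenPartialHomeomorph (X × ℂ) (Cd (2 * n) × ℂ)}, IsTotalSpaceEq L k ν (y, 0) F →
      IsGermIso (𝓘(ℂ, Cd (2 * n)).prod 𝓘(ℂ, ℂ)) 𝓘(ℂ, Cd (2 * n) × ℂ) φ F (y, 0)
        (fun w => (∑ i, w.1 i ^ 2) - w.2 ^ (l + 1)) 0 →
      (IsSingularZero (𝓘(ℂ, Cd (2 * n)).prod 𝓘(ℂ, ℂ)) F (y, 0) ↔ 1 ≤ l) := fun hF hφ =>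
    (hφ.isSingularZero_iff (hF.contMDiffAt.mdifferentiableAt hω)
      (mdifferentiableAt_normal_form _ _ _)).trans (isSingularZero_normal_form_iff _ _)
  have h0 : (0 : ℂ) ∈ Metric.ball (0 : ℂ) r := Metric.mem_ball_self hr
  refine ⟨?_, ?_⟩
  · rintro ⟨y, t⟩ hp
    have hy := mem_singMember_of_mem_singTotalSpace hp
    obtain ⟨htr, F, hF, hs⟩ := hp
    obtain rfl : t = 0 := (hD t htr).1 ⟨y, hy⟩
    obtain ⟨l, φ, hφ, -⟩ := hF.exists_isGermIso hr hD (hY₀ y hy)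
    exact ⟨rfl, hy, l, F, hF, hφ.isTypeA ((hsing hF hφ).1 hs)⟩
  · intro y hy
    -- Singularity of `Y` is witnessed by some local equation. Using that very equation when the
    -- point is singular, and an arbitrary lift of `ν` otherwise, avoids comparing the equations
    -- given by different lifts.
    by_cases hp : (y, (0 : ℂ)) ∈ singTotalSpace L k ν (Metric.ball 0 r)
    · obtain ⟨-, F, hF, hs⟩ := id hp
      obtain ⟨l, φ, hφ, hφ2⟩ := hF.exists_isGermIso hr hD (hY₀ y hy)
      exact ⟨l, ⟨F, hF, φ, hφ, hφ2⟩, fun _ => (hsing hF hφ).1 hs, fun _ => hp⟩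
    · obtain ⟨a, ha⟩ := hν 0 h0
      have hF : IsTotalSpaceEq L k ν (y, 0) fun z => localFun L k y (a z.2) z.1 := ⟨a, ha, rfl⟩
      obtain ⟨l, φ, hφ, hφ2⟩ := hF.exists_isGermIso hr hD (hY₀ y hy)
      exact ⟨l, ⟨_, hF, φ, hφ, hφ2⟩, fun h => absurd h hp,
        fun hl => ⟨h0, _, hF, (hsing hF hφ).2 hl⟩⟩
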